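/- Let $d\ge 1$, let $|\cdot|$ be any norm on $\mathbb R^d$, let $B(x,\rho)$ denote its closed balls and let $\lambda_d$ be Lebesgue measure. For a nonempty finite set $\alpha\subset\mathbb R^d$ write $d(x,\alpha)=\min_{a\in\alpha}|x-a|$. Let $\widehat X^{\alpha}=\sum_{a\in\alpha}a\,\mathbf 1_{\{X\in C_a(\alpha)\}}$ be a Voronoi quantization of a random vector $X$, that is, $(C_a(\alpha))_{a\in\alpha}$ is any Borel partition of $\mathbb R^d$ with $C_a(\alpha)\subset\{x:|x-a|=d(x,\alpha)\}$; and write $\|Y\|_s^s=\mathbb E|Y|^s$. Let $0<r<s<\infty$, and let $X$ be an $\mathbb R^d$-valued random variable with distribution $P=f\cdot\lambda_d$, where $f:\mathbb R^d\to[0,\infty)$ is Borel, such that $\mathbb E|X|^{r+\eta}<\infty$ for some $\eta>0$. Let $b\in(0,1/2)$. Then there is a real constant $C(b)>0$, depending only on $b$, $r$, $s$, $d$, the norm and the distribution $P$ (in particular neither on $\theta$, $\mu$, nor on the quantizers $\alpha_n$, nor on $n$), such that the following holds. Let $\theta>0$ and $\mu\in\mathbb R^d$ be such that the distribution $P_{\theta,\mu}$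 of $\frac{X-\mu}{\theta}+\mu$ is absolutely continuous with respect to $P$. Let $(\alpha_n)_{n\ge1}$ be an $L^r(P)$-optimal sequence of quantizers, i.e. for every $n\ge1$, $\alpha_n$ is a nonempty set of at most $n$ points and $$\int d(x,\alpha_n)^r\,dP(x)=\inf\Big\{\int d(x,\alpha)^r\,dP(x):\ \emptyset\ne\alpha\subset\mathbb R^d,\ \operatorname{card}\alpha\le n\Big\}.$$ Suppose that the maximal function $$\psi_b(x)=\sup_{n\ge1}\frac{\lambda_d\big(B(x,b\,d(x,\alpha_n))\big)}{P\big(B(x,b\,d(x,\alpha_n))\big)}\in[0,\infty]$$ satisfies $\psi_b^{s/(d+r)}\in L^1(P_{\theta,\mu})$. Put $\alpha_n^{\theta,\mu}=\{\mu+\theta(a-\mu):a\in\alpha_n\}$ and $f_{\theta,\mu}(x)=f(\mu+\theta(x-\mu))$. Then, with the convention $0\cdot\infty=0$ in the integrand, $$\limsup_{n\to\infty} n^{s/d}\,\big\|X-\widehat X^{\alpha_n^{\theta,\mu}}\big\|_s^s\ \le\ \theta^{s+d}\,C(b)\int_{\mathbb R^d} f_{\theta,\mu}\,f^{-\frac{s}{d+r}}\,d\lambda_d\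 <\ +\infty .$$ -/

import Mathlib

open MeasureTheory ProbabilityTheory Filter
open scoped ENNReal NNReal

namespace Quantization

noncomputable section

variable {E : Type*} [NormedAddCommGroup E] [NormedSpace ℝ E] [MeasurableSpace E]

/-- `∫ d(x, α)^r dP(x)`, where `d(x, α) = min_{a ∈ α} |x - a|` (used for nonempty `α` only). -/
def distortion (P : Measure E) (r : ℝ) (α : Finset E) : ℝ≥0∞ :=
  ∫⁻ x, ENNReal.ofReal (Metric.infDist x (α : Set E)) ^ r ∂P

/-- The `n`-th `L^r`-quantization error `e_{n,r}(P)`: the infimum of `(∫ d(x, α)^r dP(x))^{1/r}`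
over the nonempty codebooks `α` with at most `n` points. -/
def quantizationError (P : Measure E) (r : ℝ) (n : ℕ) : ℝ≥0∞ :=
  ⨅ (α : Finset E) (_ : α.Nonempty) (_ : α.card ≤ n), distortion P r α ^ (1 / r)

/-- `(α_n)_{n ≥ 1}` is an (exactly) `L^r(P)`-optimal sequence of quantizers. The value `α 0` is
irrelevant. -/
def IsOptimalSequence (P : Measure E) (r : ℝ) (α : ℕ → Finset E) : Prop :=
  ∀ n : ℕ, 1 ≤ n → (α n).Nonempty ∧ (α n).card ≤ n ∧
    quantizationError P r n ^ r = distortion P r (α n)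

/-- The maximal function `ψ_b(x) = sup_{n ≥ 1} vol(B(x, b d(x, α_n))) / P(B(x, b d(x, α_n)))`,
with values in `[0, ∞]`; a quotient `c / 0` with `c > 0` is `∞`, and `0 / 0` (which occurs only
at the points `x` of the codebooks, when `P` is absolutely continuous) is `0`. -/
def maximalFunction (vol P : Measure E) (α : ℕ → Finset E) (b : ℝ) (x : E) : ℝ≥0∞ :=
  ⨆ (n : ℕ) (_ : 1 ≤ n),
    vol (Metric.closedBall x (b * Metric.infDist x (α n : Set E))) /
      P (Metric.closedBall x (b * Metric.infDist x (α n : Set E)))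

open Classical in
/-- The codebook `α^{θ,μ} = {μ + θ (a - μ) : a ∈ α}`. -/
def dilate (θ : ℝ) (μ : E) (α : Finset E) : Finset E :=
  α.image fun a => μ + θ • (a - μ)

/-- `P_{θ,μ}`, the image of `P` under `x ↦ (x - μ) / θ + μ`. -/
def dilatedLaw (θ : ℝ) (μ : E) (P : Measure E) : Measure E :=
  P.map fun x => θ⁻¹ • (x - μ) + μ

/-- `(C_a)_{a ∈ α}` is a Voronoi partition of the space with respect to the codebook `α`. -/
structure IsVoronoiPartition (α : Finset E) (C : E → Set E) : Prop where
  measurableSet : ∀ a ∈ α, MeasurableSet (C a)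
  disjoint : ∀ a ∈ α, ∀ a' ∈ α, a ≠ a' → Disjoint (C a) (C a')
  covers : ∀ x, ∃ a ∈ α, x ∈ C a
  nearest : ∀ a ∈ α, ∀ x ∈ C a, ∀ a' ∈ α, ‖x - a‖ ≤ ‖x - a'‖

/-- The quantization `X̂ = ∑_{a ∈ α} a 1_{X ∈ C_a}` of `X` associated with the cells `C_a`. -/
def voronoiQuantization {Ω : Type*} (α : Finset E) (C : E → Set E) (X : Ω → E) (ω : Ω) : E :=
  ∑ a ∈ α, (X ⁻¹' C a).indicator (fun _ => a) ω

end

end Quantization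

/-! Write `D n` for the distortion of `α n`, and put `ρ = d(x, α n)`, `B = B(x, bρ)`. Adding `x` to
`α n` lowers the distance on `B` from at least `(1-b)ρ` to at most `bρ`, so optimality gives
`((1-b)^r - b^r) ρ^r P(B) ≤ D n - D (n+1)`. If this increment is `O(n^{-(1+r/d)})`, multiplying by
`ρ^d`, which is proportional to `vol B`, bounds `n^{s/d} ρ^s` by a constant times `(vol B / P
B)^{s/(d+r)}`. That ratio is dominated by `ψ_b` and tends to `1/f` by Lebesgue differentiation,
since `ρ → 0` on the support of `P`. Reverse Fatou under the dilated law concludes; the dilation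
contributes `θ^s` through distances and `θ^d` through the density.

The increment bound is the main work. Deleting `a` from `α (n+1)` costs at most a constant times the
distortion on the cell of `a` plus `δ(a)^r P(cell of a)`, where `δ(a)` is the distance from `a` to
the other points. The last product factors as `A a * G a ^ (r/d)`: the sum of the `A a` is
controlled by the moment of order `r + η`, the sum of the `G a` by a weighted packing bound.
Averaging over the `n+1` points yields one that is cheap in all three respects. Pierce's bound `D n
= O(n^{-r/d})`, from a maximal separated set whose scale grows with the norm, supplies the rate. -/

namespace Quantization

/-! ### Weighted packing and moment bounds -/

section Packing

variable {E : Type*} [NormedAddCommGroup E] [NormedSpace ℝ E] [FiniteDimensional ℝ E]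
  [MeasurableSpace E] [BorelSpace E]

/-- Weighted packing bound: disjoint balls whose radii grow at most linearly have a bounded total
volume with respect to the weight `(1 + ‖x‖)^{-(d + ε)}`. -/
theorem exists_packing_sum_le [Nontrivial E] (vol : Measure E) [vol.IsAddHaarMeasure] {ε L : ℝ}
    (hε : 0 < ε) (hL : 0 ≤ L) :
    ∃ M : ℝ, 0 < M ∧ ∀ (α : Finset E) (ρ : E → ℝ),
      (∀ a ∈ α, 0 ≤ ρ a ∧ ρ a ≤ L * (1 + ‖a‖)) →
      (α : Set E).PairwiseDisjoint (fun a => Metric.ball a (ρ a)) →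
      ∑ a ∈ α, ρ a ^ (Module.finrank ℝ E) *
        (1 + ‖a‖) ^ (-((Module.finrank ℝ E : ℝ) + ε)) ≤ M := by
  set d := Module.finrank ℝ E with hd
  set p : ℝ := (d : ℝ) + ε with hp
  have hp0 : 0 < p := by positivity
  have hJ : ∫⁻ x : E, ENNReal.ofReal ((1 + ‖x‖) ^ (-p)) ∂vol < ∞ :=
    finite_integral_one_add_norm (by rw [hp]; linarith)
  set J := ∫⁻ x : E, ENNReal.ofReal ((1 + ‖x‖) ^ (-p)) ∂vol with hJdef
  have hv0 : vol (Metric.ball (0 : E) 1) ≠ 0 :=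
    (Metric.measure_ball_pos vol 0 one_pos).ne'
  have hvt : vol (Metric.ball (0 : E) 1) ≠ ∞ := measure_ball_lt_top.ne
  set v := vol (Metric.ball (0 : E) 1) with hv
  have hvpos : 0 < v.toReal := ENNReal.toReal_pos hv0 hvt
  -- The `+ 1` only serves to make the constant positive.
  refine ⟨(1 + L) ^ p * J.toReal / v.toReal + 1, by positivity, fun α ρ hρ hdisj => ?_⟩
  -- On the ball around `a` one has `1 + ‖x‖ ≤ (1 + L)(1 + ‖a‖)`, so each summand is controlled by
  -- the integral of the weight over that ball; disjointness then bounds the sum by the integral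
  -- over the whole space.
  have hball : ∀ a ∈ α, ENNReal.ofReal (((1 + L) * (1 + ‖a‖)) ^ (-p) * ρ a ^ d) * v ≤
      ∫⁻ x in Metric.ball a (ρ a), ENNReal.ofReal ((1 + ‖x‖) ^ (-p)) ∂vol := by
    intro a ha
    obtain ⟨h0, h1⟩ := hρ a ha
    rw [ENNReal.ofReal_mul (by positivity), mul_assoc, ← Measure.addHaar_ball vol a h0,
      ← setLIntegral_const]
    refine setLIntegral_mono' measurableSet_ball fun x hx => ?_
    refine ENNReal.ofReal_le_ofReal ?_
    refine Real.rpow_le_rpow_of_nonpos (by positivity) ?_ (by linarith)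
    have hx' : ‖x - a‖ < ρ a := by simpa [dist_eq_norm] using hx
    have : ‖x‖ ≤ ‖a‖ + ‖x - a‖ := by simpa using norm_add_le a (x - a)
    nlinarith
  have hsum : ENNReal.ofReal (∑ a ∈ α, ((1 + L) * (1 + ‖a‖)) ^ (-p) * ρ a ^ d) * v ≤ J := by
    rw [ENNReal.ofReal_sum_of_nonneg, Finset.sum_mul]
    · refine (Finset.sum_le_sum hball).trans ?_
      rw [← lintegral_biUnion_finset hdisj (fun _ _ => measurableSet_ball)]
      exact setLIntegral_le_lintegral _ _
    · intro a ha
      have := (hρ a ha).1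
      positivity
  have hS0 : 0 ≤ ∑ a ∈ α, ((1 + L) * (1 + ‖a‖)) ^ (-p) * ρ a ^ d :=
    Finset.sum_nonneg fun a ha => by have := (hρ a ha).1; positivity
  have hreal : (∑ a ∈ α, ((1 + L) * (1 + ‖a‖)) ^ (-p) * ρ a ^ d) * v.toReal ≤ J.toReal := by
    have := ENNReal.toReal_mono hJ.ne hsum
    rwa [ENNReal.toReal_mul, ENNReal.toReal_ofReal hS0] at this
  have heq : ∑ a ∈ α, ((1 + L) * (1 + ‖a‖)) ^ (-p) * ρ a ^ d =
      (1 + L) ^ (-p) * ∑ a ∈ α, ρ a ^ d * (1 + ‖a‖) ^ (-p) := by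
    rw [Finset.mul_sum]
    refine Finset.sum_congr rfl fun a _ => ?_
    rw [Real.mul_rpow (by positivity) (by positivity)]
    ring
  rw [heq, Real.rpow_neg (by positivity)] at hreal
  have hLp : 0 < (1 + L) ^ p := by positivity
  have : ∑ a ∈ α, ρ a ^ d * (1 + ‖a‖) ^ (-p) ≤ (1 + L) ^ p * J.toReal / v.toReal := by
    rw [le_div_iff₀ hvpos]
    calc _ = (1 + L) ^ p * (((1 + L) ^ p)⁻¹ * (∑ a ∈ α, ρ a ^ d * (1 + ‖a‖) ^ (-p)) *
          v.toReal) := by field_simp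
      _ ≤ _ := by gcongr
  linarith

theorem ennreal_add_rpow_le (u v : ℝ≥0∞) {r : ℝ} (hr : 0 ≤ r) :
    (u + v) ^ r ≤ 2 ^ r * (u ^ r + v ^ r) := by
  rcases le_total u v with h | h
  · calc (u + v) ^ r ≤ (2 * v) ^ r := by gcongr; rw [two_mul]; gcongr
      _ = 2 ^ r * v ^ r := ENNReal.mul_rpow_of_nonneg _ _ hr
      _ ≤ _ := by gcongr; exact le_add_self
  · calc (u + v) ^ r ≤ (2 * u) ^ r := by gcongr; rw [two_mul]; gcongr
      _ = 2 ^ r * u ^ r := ENNReal.mul_rpow_of_nonneg _ _ hr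
      _ ≤ _ := by gcongr; exact le_self_add

omit [NormedSpace ℝ E] [FiniteDimensional ℝ E] [BorelSpace E] in
theorem lintegral_one_add_norm_rpow_lt_top (P : Measure E) [IsFiniteMeasure P] {q : ℝ}
    (hq : 0 ≤ q) (h : ∫⁻ x, ‖x‖ₑ ^ q ∂P < ∞) :
    ∫⁻ x, ENNReal.ofReal (1 + ‖x‖) ^ q ∂P < ∞ := by
  calc ∫⁻ x, ENNReal.ofReal (1 + ‖x‖) ^ q ∂P ≤ ∫⁻ x, 2 ^ q * (1 + ‖x‖ₑ ^ q) ∂P := by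
        refine lintegral_mono fun x => ?_
        rw [ENNReal.ofReal_add zero_le_one (norm_nonneg _), ENNReal.ofReal_one, ofReal_norm]
        simpa using ennreal_add_rpow_le 1 ‖x‖ₑ hq
    _ = 2 ^ q * (P Set.univ + ∫⁻ x, ‖x‖ₑ ^ q ∂P) := by
        rw [lintegral_const_mul' _ _ (by finiteness), lintegral_add_left measurable_const]
        simp
    _ < ∞ := by
        refine ENNReal.mul_lt_top (by finiteness) (ENNReal.add_lt_top.2 ⟨by finiteness, h⟩)

end Packing

/-- The weight `(1 + ‖x‖)^{1 + κ}`, the local scale of the separated sets below. -/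
noncomputable def weight {E : Type*} [NormedAddCommGroup E] (κ : ℝ) (x : E) : ℝ :=
  (1 + ‖x‖) ^ (1 + κ)

/-! ### Weighted nets and Pierce's bound -/

section Pierce

variable {E : Type*} [NormedAddCommGroup E] [NormedSpace ℝ E] [FiniteDimensional ℝ E]
  [MeasurableSpace E] [BorelSpace E] [Nontrivial E]

/-- A set of points which is separated at the scale `t` relative to the weight, inside the region
where the local scale is below `1 + ‖x‖`. -/
def IsWeightSeparated {E : Type*} [NormedAddCommGroup E] (κ t : ℝ) (α : Finset E) : Prop :=
  (∀ a ∈ α, t * weight κ a ≤ 1 + ‖a‖) ∧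
    ∀ a ∈ α, ∀ a' ∈ α, a ≠ a' → t * (weight κ a + weight κ a') / 2 ≤ ‖a - a'‖

/-- The balls of radius `t * weight κ a / 2` are disjoint. With `ε = κ d` the packing weight cancels
`weight κ a ^ d` exactly, so every point contributes `(t / 2) ^ d`. -/
theorem exists_card_le_of_isWeightSeparated (vol : Measure E) [vol.IsAddHaarMeasure] {κ : ℝ}
    (hκ : 0 < κ) :
    ∃ M : ℝ, 0 < M ∧ ∀ t : ℝ, 0 < t → ∀ α : Finset E, IsWeightSeparated κ t α →
      (α.card : ℝ) * (t / 2) ^ (Module.finrank ℝ E) ≤ M := by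
  have hd : 0 < Module.finrank ℝ E := Module.finrank_pos
  obtain ⟨M, hM, h⟩ := exists_packing_sum_le vol (ε := κ * Module.finrank ℝ E) (L := 1)
    (by positivity) zero_le_one
  refine ⟨M, hM, fun t ht α hα => ?_⟩
  have hw : ∀ a : E, 0 < weight κ a := fun a => by unfold weight; positivity
  refine le_trans (le_of_eq ?_) (h α (fun a => t * weight κ a / 2) ?_ ?_)
  · rw [← nsmul_eq_mul, ← Finset.sum_const]
    refine Finset.sum_congr rfl fun a _ => ?_
    have h1 : (0 : ℝ) < 1 + ‖a‖ := by positivity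
    have h2 : weight κ a ^ (Module.finrank ℝ E) *
        (1 + ‖a‖) ^ (-((Module.finrank ℝ E : ℝ) + κ * Module.finrank ℝ E)) = 1 := by
      unfold weight
      rw [← Real.rpow_natCast, ← Real.rpow_mul h1.le, ← Real.rpow_add h1]
      convert Real.rpow_zero _ using 2
      ring
    rw [mul_div_right_comm, mul_pow, mul_assoc, h2, mul_one]
  · intro a ha
    have := hα.1 a ha
    have := mul_pos ht (hw a)
    constructor <;> linarith [norm_nonneg a]
  · intro a ha a' ha' hne
    refine Metric.ball_disjoint_ball ?_
    have := hα.2 a ha a' ha' hne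
    rw [dist_eq_norm]
    linarith

-- The hypotheses give `‖a‖ ≤ ‖x‖ + (2 + ‖x‖ + ‖a‖) / 2`, hence `1 + ‖a‖ ≤ 3 (1 + ‖x‖)`.
omit [NormedSpace ℝ E] [FiniteDimensional ℝ E] [MeasurableSpace E] [BorelSpace E]
  [Nontrivial E] in
theorem weight_le_of_norm_sub_le {κ t : ℝ} (hκ : 0 < κ) {a x : E}
    (ha : t * weight κ a ≤ 1 + ‖a‖) (hx : t * weight κ x ≤ 1 + ‖x‖)
    (h : ‖x - a‖ ≤ t * (weight κ x + weight κ a) / 2) : weight κ a ≤ 3 ^ (1 + κ) * weight κ x := by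
  unfold weight at *
  rw [← Real.mul_rpow (by positivity) (by positivity)]
  refine Real.rpow_le_rpow (by positivity) ?_ (by positivity)
  have : ‖a‖ ≤ ‖x‖ + ‖x - a‖ := by
    have := norm_sub_le x (x - a)
    simpa using this
  linarith

/-- A maximal weight-separated set is a net at the same scale: a point that cannot be added lies
close to the set. -/
theorem exists_infDist_le_weight (vol : Measure E) [vol.IsAddHaarMeasure] {κ : ℝ} (hκ : 0 < κ) :
    ∃ M : ℝ, 0 < M ∧ ∀ n : ℕ, 1 ≤ n → ∃ α : Finset E, α.Nonempty ∧ α.card ≤ n ∧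
      ∀ x, Metric.infDist x (α : Set E) ≤
        M * (n : ℝ) ^ (-(1 / (Module.finrank ℝ E : ℝ))) * weight κ x := by
  classical
  obtain ⟨M, hM, hcard⟩ := exists_card_le_of_isWeightSeparated (E := E) vol hκ
  have hw : ∀ a : E, 0 < weight κ a := fun a => by unfold weight; positivity
  have hd : 0 < Module.finrank ℝ E := Module.finrank_pos
  set d := Module.finrank ℝ E
  refine ⟨3 ^ (1 + κ) * (2 * M ^ (1 / (d : ℝ))), by positivity, fun n hn => ?_⟩
  have hn0 : (0 : ℝ) < n := by exact_mod_cast hn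
  -- Chosen so that `(t / 2) ^ d = M / n`, which turns the packing bound into `card ≤ n`.
  set t : ℝ := 2 * (M ^ (1 / (d : ℝ)) * (n : ℝ) ^ (-(1 / (d : ℝ)))) with ht
  have htpos : 0 < t := by positivity
  have hone : (1 : ℝ) ≤ 3 ^ (1 + κ) := Real.one_le_rpow (by norm_num) (by positivity)
  have htd : (t / 2) ^ d = M / n := by
    rw [ht, mul_div_cancel_left₀ _ (two_ne_zero), mul_pow, ← Real.rpow_natCast,
      ← Real.rpow_natCast, ← Real.rpow_mul hM.le, ← Real.rpow_mul hn0.le, neg_mul,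
      one_div_mul_cancel (by positivity), Real.rpow_one, Real.rpow_neg_one, div_eq_mul_inv]
  have hcard' : ∀ α : Finset E, IsWeightSeparated κ t α → α.card ≤ n := by
    intro α hα
    have h1 := hcard t htpos α hα
    rw [htd, ← mul_div_assoc, div_le_iff₀ hn0, mul_comm M] at h1
    exact_mod_cast le_of_mul_le_mul_right h1 hM
  have hgoal : ∀ x : E, 3 ^ (1 + κ) * (2 * M ^ (1 / (d : ℝ))) * (n : ℝ) ^ (-(1 / (d : ℝ))) *
      weight κ x = 3 ^ (1 + κ) * (t * weight κ x) := fun x => by rw [ht]; ring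
  simp only [hgoal]
  -- Where the local scale exceeds `1 + ‖x‖`, the point `0` alone is near enough.
  have hfar : ∀ (α : Finset E) (x : E), (0 : E) ∈ α → 1 + ‖x‖ < t * weight κ x →
      Metric.infDist x (α : Set E) ≤ 3 ^ (1 + κ) * (t * weight κ x) := by
    intro α x h0 hx
    have h1 : Metric.infDist x (α : Set E) ≤ ‖x‖ := by
      simpa using Metric.infDist_le_dist_of_mem (x := x) (Finset.mem_coe.2 h0)
    have h2 : 0 < t * weight κ x := mul_pos htpos (hw x)
    nlinarith
  -- For `t ≤ 1` the set `{0}` is separated and can be enlarged to a maximal one; for `t > 1` every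
  -- `x` is in the far region.
  by_cases ht1 : t ≤ 1
  · have hw0 : weight κ (0 : E) = 1 := by simp [weight]
    obtain ⟨α, ⟨hα, h0⟩, hmax⟩ := WellFounded.has_min
      (measure (fun β : Finset E => n - β.card)).wf
      {α : Finset E | IsWeightSeparated κ t α ∧ (0 : E) ∈ α}
      ⟨{0}, ⟨by simpa [hw0] using ht1, by simp⟩, by simp⟩
    refine ⟨α, ⟨0, h0⟩, hcard' α hα, fun x => ?_⟩
    by_cases hx : t * weight κ x ≤ 1 + ‖x‖
    · obtain ⟨a, ha, hax⟩ : ∃ a ∈ α, ‖x - a‖ ≤ t * (weight κ x + weight κ a) / 2 := by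
        by_contra! hcon
        have hxα : x ∉ α := fun hxα => by
          have := hcon x hxα
          have h2 : 0 < t * (weight κ x + weight κ x) / 2 := by have := hw x; positivity
          simp only [sub_self, norm_zero] at this
          linarith
        have hins : IsWeightSeparated κ t (insert x α) := by
          refine ⟨fun a ha => ?_, fun a ha a' ha' hne => ?_⟩
          · rcases Finset.mem_insert.1 ha with rfl | ha
            · exact hx
            · exact hα.1 a ha
          · rcases Finset.mem_insert.1 ha with rfl | haα <;>
              rcases Finset.mem_insert.1 ha' with rfl | haα'
            · exact absurd rfl hne
            · exact (hcon a' haα').le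
            · rw [norm_sub_rev, add_comm]
              exact (hcon a haα).le
            · exact hα.2 a haα a' haα' hne
        have hc := hcard' _ hins
        have := hmax _ ⟨hins, Finset.mem_insert_of_mem h0⟩
        apply this
        change n - (insert x α).card < n - α.card
        rw [Finset.card_insert_of_notMem hxα] at hc ⊢
        omega
      have hwa := weight_le_of_norm_sub_le hκ (hα.1 a ha) hx hax
      calc Metric.infDist x (α : Set E) ≤ dist x a := Metric.infDist_le_dist_of_mem ha
        _ = ‖x - a‖ := dist_eq_norm _ _
        _ ≤ t * (weight κ x + weight κ a) / 2 := hax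
        _ ≤ t * (3 ^ (1 + κ) * weight κ x + 3 ^ (1 + κ) * weight κ x) / 2 := by
            gcongr
            exact le_mul_of_one_le_left (hw x).le hone
        _ = _ := by ring
    · exact hfar α x h0 (not_le.1 hx)
  · refine ⟨{0}, by simp, by simpa using hn, fun x => hfar _ x (by simp) ?_⟩
    have h1 : 1 + ‖x‖ ≤ weight κ x := by
      unfold weight
      exact Real.self_le_rpow_of_one_le (by linarith [norm_nonneg x]) (by linarith)
    have := norm_nonneg x
    nlinarith [not_le.1 ht1]

/-- Pierce's upper bound: under a moment of order `r + η` the `n`-point distortion is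
`O(n^{-r/d})`. -/
theorem exists_distortion_le (vol : Measure E) [vol.IsAddHaarMeasure] (P : Measure E)
    [IsFiniteMeasure P] {r η : ℝ} (hr : 0 < r) (hη : 0 < η)
    (hmom : ∫⁻ x, ‖x‖ₑ ^ (r + η) ∂P < ∞) :
    ∃ K : ℝ, 0 < K ∧ ∀ n : ℕ, 1 ≤ n → ∃ α : Finset E, α.Nonempty ∧ α.card ≤ n ∧
      distortion P r α ≤ ENNReal.ofReal (K * (n : ℝ) ^ (-(r / (Module.finrank ℝ E : ℝ)))) := by
  obtain ⟨M, hM, h⟩ := exists_infDist_le_weight (E := E) vol (κ := η / r) (by positivity)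
  have hQ := lintegral_one_add_norm_rpow_lt_top P (by positivity) hmom
  set Q := ∫⁻ x, ENNReal.ofReal (1 + ‖x‖) ^ (r + η) ∂P with hQdef
  refine ⟨M ^ r * (Q.toReal + 1), by positivity, fun n hn => ?_⟩
  have hn0 : (0 : ℝ) < n := by exact_mod_cast hn
  obtain ⟨α, hne, hc, hα⟩ := h n hn
  refine ⟨α, hne, hc, ?_⟩
  set m : ℝ := M * (n : ℝ) ^ (-(1 / (Module.finrank ℝ E : ℝ))) with hm
  have hm0 : 0 < m := by positivity
  have hmr : m ^ r = M ^ r * (n : ℝ) ^ (-(r / (Module.finrank ℝ E : ℝ))) := by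
    rw [hm, Real.mul_rpow hM.le (by positivity), ← Real.rpow_mul hn0.le]
    congr 2
    ring
  calc distortion P r α ≤ ∫⁻ x, ENNReal.ofReal (m ^ r) * ENNReal.ofReal (1 + ‖x‖) ^ (r + η) ∂P := by
        refine lintegral_mono fun x => ?_
        have h1 : (0 : ℝ) < 1 + ‖x‖ := by positivity
        have hw : 0 < weight (η / r) x := by unfold weight; positivity
        rw [ENNReal.ofReal_rpow_of_pos h1, ← ENNReal.ofReal_mul (by positivity),
          ENNReal.ofReal_rpow_of_nonneg Metric.infDist_nonneg hr.le]
        refine ENNReal.ofReal_le_ofReal ?_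
        calc _ ≤ (m * weight (η / r) x) ^ r :=
              Real.rpow_le_rpow Metric.infDist_nonneg (hα x) hr.le
          _ = _ := by
              rw [Real.mul_rpow hm0.le hw.le, weight, ← Real.rpow_mul h1.le]
              congr 2
              field_simp
    _ = ENNReal.ofReal (m ^ r) * Q := lintegral_const_mul' _ _ ENNReal.ofReal_ne_top
    _ ≤ ENNReal.ofReal (m ^ r) * ENNReal.ofReal (Q.toReal + 1) := by
        gcongr
        rw [ENNReal.le_ofReal_iff_toReal_le hQ.ne (by positivity)]
        linarith
    _ = _ := by
        rw [← ENNReal.ofReal_mul (by positivity), hmr]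
        congr 1
        ring

end Pierce

/-! ### Measurable nearest-point selection -/

section NearestPoint

variable {E : Type*} [NormedAddCommGroup E] [MeasurableSpace E] [BorelSpace E]

theorem exists_measurable_nearest [SecondCountableTopology E] (α : Finset E) (hα : α.Nonempty) :
    ∃ π : E → E, Measurable π ∧ ∀ x, π x ∈ α ∧ Metric.infDist x (α : Set E) = dist x (π x) := by
  classical
  induction hα using Finset.Nonempty.cons_induction with
  | singleton a => exact ⟨fun _ => a, measurable_const, fun x => by simp⟩
  | cons a α ha hα ih =>
    obtain ⟨π, hπ, h⟩ := ih
    refine ⟨fun x => if dist x a ≤ dist x (π x) then a else π x, ?_, fun x => ?_⟩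
    · refine Measurable.ite ?_ measurable_const hπ
      exact measurableSet_le (measurable_id.dist measurable_const) (measurable_id.dist hπ)
    · have hinf : Metric.infDist x (α.cons a ha : Set E) = min (dist x a) (dist x (π x)) := by
        rw [← (h x).2]
        apply le_antisymm
        · refine le_min (Metric.infDist_le_dist_of_mem (by simp)) ?_
          exact Metric.infDist_le_infDist_of_subset (by simp) (by simpa using hα)
        · rw [Metric.le_infDist (by simp)]
          intro y hy
          rcases (by simpa using hy : y = a ∨ y ∈ α) with rfl | hy
          · exact min_le_left _ _
          · exact (min_le_right _ _).trans (Metric.infDist_le_dist_of_mem hy)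
      rw [hinf]
      dsimp only
      split_ifs with hc
      · exact ⟨by simp, min_eq_left hc⟩
      · exact ⟨by simp [(h x).1], min_eq_right (not_le.1 hc).le⟩

end NearestPoint

/-! ### Cost of removing a point from a codebook -/

section Erase

variable {E : Type*} [NormedAddCommGroup E] [NormedSpace ℝ E] [FiniteDimensional ℝ E]
  [MeasurableSpace E] [BorelSpace E]

omit [NormedSpace ℝ E] [FiniteDimensional ℝ E] in
theorem sum_setLIntegral_fiber {α : Finset E} {π : E → E} (hπ : Measurable π)
    (hmem : ∀ x, π x ∈ α) (P : Measure E) (g : E → ℝ≥0∞) :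
    ∑ a ∈ α, ∫⁻ x in π ⁻¹' {a}, g x ∂P = ∫⁻ x, g x ∂P := by
  rw [← lintegral_biUnion_finset]
  · have : ⋃ a ∈ α, π ⁻¹' {a} = Set.univ := by
      ext x; simp [hmem x]
    rw [this, Measure.restrict_univ]
  · intro a _ a' _ hne
    exact Disjoint.preimage _ (by simpa using hne)
  · exact fun a _ => hπ (measurableSet_singleton a)

-- Outside the cell of `a` the selected nearest point survives; on it, the triangle inequality goes
-- through `a` to the nearest remaining point.
omit [NormedSpace ℝ E] [FiniteDimensional ℝ E] in
open Classical in
theorem distortion_erase_le {r : ℝ} (hr : 0 < r) (P : Measure E) {α : Finset E} {π : E → E}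
    (hπ : Measurable π)
    (hnear : ∀ x, π x ∈ α ∧ Metric.infDist x (α : Set E) = dist x (π x)) (a : E) :
    distortion P r (α.erase a) ≤ distortion P r α +
      2 ^ r * (∫⁻ x in π ⁻¹' {a}, ENNReal.ofReal (Metric.infDist x (α : Set E)) ^ r ∂P +
        ENNReal.ofReal (Metric.infDist a (α.erase a : Set E)) ^ r * P (π ⁻¹' {a})) := by
  have hmeas : MeasurableSet (π ⁻¹' {a}) := hπ (measurableSet_singleton a)
  unfold distortion
  rw [← lintegral_add_compl _ hmeas, add_comm]
  refine add_le_add ?_ ?_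
  · refine le_trans (setLIntegral_mono' hmeas.compl fun x hx => ?_) (setLIntegral_le_lintegral _ _)
    gcongr
    rw [(hnear x).2]
    refine Metric.infDist_le_dist_of_mem ?_
    simpa [(hnear x).1] using hx
  · rw [← setLIntegral_const, ← lintegral_add_right _ measurable_const,
      ← lintegral_const_mul' _ _ (by finiteness)]
    refine setLIntegral_mono' hmeas fun x hx => ?_
    refine le_trans ?_ (ennreal_add_rpow_le _ _ hr.le)
    gcongr
    rw [← ENNReal.ofReal_add Metric.infDist_nonneg Metric.infDist_nonneg]
    refine ENNReal.ofReal_le_ofReal ?_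
    have hxa : π x = a := by simpa using hx
    have := (hnear x).2
    rw [hxa] at this
    rw [this, add_comm]
    exact Metric.infDist_le_infDist_add_dist

open Classical in
/-- In a codebook with `N` points, two of which stay in a fixed ball, some point can be removed at
the cost `O(Z / N + N^{-(1 + r/d)})`, where `Z` bounds the distortion. -/
theorem exists_distortion_erase_le [Nontrivial E] (vol : Measure E) [vol.IsAddHaarMeasure] (P : Measure E)
    [IsFiniteMeasure P] {r η : ℝ} (hr : 0 < r) (hη : 0 < η)
    (hmom : ∫⁻ x, ‖x‖ₑ ^ (r + η) ∂P < ∞) {R : ℝ} (hR : 0 ≤ R) :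
    ∃ T : ℝ≥0∞, T ≠ ∞ ∧ ∀ α : Finset E, α.Nonempty →
      (∀ a ∈ α, ∃ a' ∈ α, a' ≠ a ∧ ‖a'‖ ≤ R) →
      ∀ Z : ℝ≥0∞, Z ≠ 0 → Z ≠ ∞ → distortion P r α ≤ Z →
      ∃ a ∈ α, distortion P r (α.erase a) ≤ distortion P r α +
        2 ^ r * (Z * (T / α.card) + (T / α.card) ^ (1 + r / (Module.finrank ℝ E : ℝ))) := by
  have hd : 0 < Module.finrank ℝ E := Module.finrank_pos
  -- This `ε` makes the weight in `G a ^ (r / d)` equal to `(1 + ‖a‖)^{-(r+η)}`, which cancels the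
  -- one in `A a`.
  obtain ⟨M, hM, hpack⟩ := exists_packing_sum_le vol (ε := η * Module.finrank ℝ E / r)
    (L := 1 + R) (by positivity) (by positivity)
  have hQ := lintegral_one_add_norm_rpow_lt_top P (by positivity) hmom
  set Q := ∫⁻ x, ENNReal.ofReal (1 + ‖x‖) ^ (r + η) ∂P with hQdef
  set d := Module.finrank ℝ E with hddef
  have hd' : (0 : ℝ) < d := by exact_mod_cast hd
  refine ⟨1 + ENNReal.ofReal (2 + R) ^ (r + η) * Q + 2 ^ d * ENNReal.ofReal M, ?_, ?_⟩
  · finiteness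
  intro α hα htwo Z hZ0 hZt hZ
  set T := 1 + ENNReal.ofReal (2 + R) ^ (r + η) * Q + 2 ^ d * ENNReal.ofReal M with hT
  obtain ⟨π, hπ, hnear⟩ := exists_measurable_nearest α hα
  set δ : E → ℝ := fun a => Metric.infDist a (α.erase a : Set E) with hδ
  set I : E → ℝ≥0∞ := fun a =>
    ∫⁻ x in π ⁻¹' {a}, ENNReal.ofReal (Metric.infDist x (α : Set E)) ^ r ∂P with hI
  set A : E → ℝ≥0∞ := fun a => ENNReal.ofReal (1 + ‖a‖) ^ (r + η) * P (π ⁻¹' {a}) with hA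
  set G : E → ℝ≥0∞ := fun a =>
    ENNReal.ofReal (δ a ^ d * (1 + ‖a‖) ^ (-((d : ℝ) + η * d / r))) with hG
  have hδ0 : ∀ a, 0 ≤ δ a := fun a => Metric.infDist_nonneg
  have hIsum : ∑ a ∈ α, I a / Z ≤ 1 := by
    simp only [div_eq_mul_inv]
    rw [← Finset.sum_mul, sum_setLIntegral_fiber hπ (fun x => (hnear x).1), ← div_eq_mul_inv]
    exact ENNReal.div_le_of_le_mul (by simpa [distortion] using hZ)
  have hAsum : ∑ a ∈ α, A a ≤ ENNReal.ofReal (2 + R) ^ (r + η) * Q := by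
    calc ∑ a ∈ α, A a
        = ∑ a ∈ α, ∫⁻ x in π ⁻¹' {a}, ENNReal.ofReal (1 + ‖π x‖) ^ (r + η) ∂P := by
          refine Finset.sum_congr rfl fun a _ => ?_
          simp only [hA]
          rw [← setLIntegral_const]
          refine setLIntegral_congr_fun (hπ (measurableSet_singleton a)) fun x hx => ?_
          have : π x = a := by simpa using hx
          simp [this]
      _ = ∫⁻ x, ENNReal.ofReal (1 + ‖π x‖) ^ (r + η) ∂P :=
          sum_setLIntegral_fiber hπ (fun x => (hnear x).1) P _
      _ ≤ ∫⁻ x, ENNReal.ofReal (2 + R) ^ (r + η) * ENNReal.ofReal (1 + ‖x‖) ^ (r + η) ∂P := by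
          refine lintegral_mono fun x => ?_
          rw [← ENNReal.mul_rpow_of_nonneg _ _ (by positivity),
            ← ENNReal.ofReal_mul (by positivity)]
          gcongr
          -- Comparison with a codebook point of norm at most `R` gives `‖π x‖ ≤ 2‖x‖ + R`, so
          -- moments of `π x` are controlled by those of `x`.
          obtain ⟨a₀, ha₀⟩ := hα
          obtain ⟨a', ha', -, hR'⟩ := htwo a₀ ha₀
          have h1 : dist x (π x) ≤ dist x a' := by
            rw [← (hnear x).2]
            exact Metric.infDist_le_dist_of_mem ha'
          rw [dist_eq_norm, dist_eq_norm] at h1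
          have h2 : ‖π x‖ ≤ ‖x‖ + ‖x - π x‖ := by simpa using norm_sub_le x (x - π x)
          have h3 := norm_sub_le x a'
          nlinarith [norm_nonneg x]
      _ = _ := lintegral_const_mul' _ _ (by finiteness)
  have hGsum : ∑ a ∈ α, G a ≤ 2 ^ d * ENNReal.ofReal M := by
    -- Balls of radius half the distance to the nearest other point are disjoint; a second point in
    -- the fixed ball makes these radii grow at most linearly.
    have key := hpack α (fun a => δ a / 2) ?_ ?_
    · rw [hG, ← ENNReal.ofReal_sum_of_nonneg (fun a _ => by have := hδ0 a; positivity)]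
      calc _ = ENNReal.ofReal (2 ^ d * ∑ a ∈ α, (δ a / 2) ^ d *
            (1 + ‖a‖) ^ (-((d : ℝ) + η * d / r))) := by
            congr 1
            rw [Finset.mul_sum]
            refine Finset.sum_congr rfl fun a _ => ?_
            rw [div_pow]
            field_simp
        _ ≤ ENNReal.ofReal (2 ^ d * M) := by gcongr
        _ = _ := by
            rw [ENNReal.ofReal_mul (by positivity), ENNReal.ofReal_pow (by norm_num)]
            norm_num
    · intro a ha
      obtain ⟨a', ha', hne, hR'⟩ := htwo a ha
      refine ⟨by have := hδ0 a; positivity, ?_⟩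
      have h1 : δ a ≤ dist a a' := Metric.infDist_le_dist_of_mem (by simp [ha', hne])
      rw [dist_eq_norm] at h1
      have h2 := norm_sub_le a a'
      nlinarith [norm_nonneg a, norm_nonneg a', hδ0 a]
    · intro a ha a' ha' hne
      refine Metric.ball_disjoint_ball ?_
      have h1 : δ a ≤ dist a a' :=
        Metric.infDist_le_dist_of_mem (by simpa [hne.symm] using ha')
      have h2 : δ a' ≤ dist a' a :=
        Metric.infDist_le_dist_of_mem (by simpa [hne] using ha)
      rw [dist_comm a' a] at h2
      linarith
  have hNpos : (α.card : ℝ≥0∞) ≠ 0 := by simpa using hα.ne_empty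
  -- Pigeonhole on the sum of the three quantities, so that one point is good for all of them at
  -- once.
  obtain ⟨a, ha, hle⟩ : ∃ a ∈ α, I a / Z + A a + G a ≤ T / α.card := by
    refine ENNReal.exists_le_of_sum_le hα ?_
    rw [Finset.sum_const, nsmul_eq_mul, ENNReal.mul_div_cancel hNpos (by finiteness),
      Finset.sum_add_distrib, Finset.sum_add_distrib]
    exact add_le_add (add_le_add hIsum hAsum) hGsum
  refine ⟨a, ha, ?_⟩
  refine (distortion_erase_le hr P hπ hnear a).trans ?_
  set U := T / (α.card : ℝ≥0∞)
  have h1 : I a ≤ Z * U := by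
    have : I a / Z ≤ U := (le_self_add.trans le_self_add).trans hle
    rw [mul_comm]
    exact (ENNReal.div_le_iff hZ0 hZt).1 this
  have h2 : A a ≤ U := (le_add_self.trans le_self_add).trans hle
  have h3 : G a ≤ U := le_add_self.trans hle
  have h4 : ENNReal.ofReal (δ a) ^ r * P (π ⁻¹' {a}) = A a * G a ^ (r / (d : ℝ)) := by
    have hpos : (0 : ℝ) < 1 + ‖a‖ := by positivity
    have hδa := hδ0 a
    have hGr : G a ^ (r / (d : ℝ)) =
        ENNReal.ofReal (δ a) ^ r * ENNReal.ofReal ((1 + ‖a‖) ^ (-(r + η))) := by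
      rw [hG, ENNReal.ofReal_rpow_of_nonneg (by positivity) (by positivity),
        ENNReal.ofReal_rpow_of_nonneg hδa hr.le, ← ENNReal.ofReal_mul (by positivity),
        Real.mul_rpow (by positivity) (by positivity), ← Real.rpow_natCast, ← Real.rpow_mul hδa,
        ← Real.rpow_mul hpos.le]
      congr 3
      · field_simp
      · field_simp
    simp only [hGr, hA, ENNReal.ofReal_rpow_of_pos hpos]
    have h5 : ENNReal.ofReal ((1 + ‖a‖) ^ (r + η)) * ENNReal.ofReal ((1 + ‖a‖) ^ (-(r + η))) = 1 := by
      rw [← ENNReal.ofReal_mul (by positivity), ← Real.rpow_add hpos]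
      simp
    calc _ = ENNReal.ofReal (δ a) ^ r * P (π ⁻¹' {a}) * 1 := (mul_one _).symm
      _ = _ := by rw [← h5]; ring
  gcongr
  rw [h4, ENNReal.rpow_add_of_nonneg _ _ zero_le_one (by positivity), ENNReal.rpow_one]
  gcongr

end Erase

/-! ### Distortion increments and pointwise bounds for optimal sequences -/

section Optimal

variable {E : Type*} [NormedAddCommGroup E] [NormedSpace ℝ E] [MeasurableSpace E]

omit [NormedSpace ℝ E] in
theorem IsOptimalSequence.distortion_le {P : Measure E} {r : ℝ} (hr : 0 < r) {α : ℕ → Finset E}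
    (hα : IsOptimalSequence P r α) {n : ℕ} (hn : 1 ≤ n) {β : Finset E} (hβ : β.Nonempty)
    (hc : β.card ≤ n) : distortion P r (α n) ≤ distortion P r β := by
  rw [← (hα n hn).2.2]
  calc quantizationError P r n ^ r ≤ (distortion P r β ^ (1 / r)) ^ r := by
        gcongr
        exact iInf_le_of_le β (iInf_le_of_le hβ (iInf_le _ hc))
    _ = distortion P r β := by
        rw [← ENNReal.rpow_mul, one_div_mul_cancel hr.ne', ENNReal.rpow_one]

variable [BorelSpace E]

omit [NormedSpace ℝ E] in
open Classical in
/-- The gain in distortion obtained by adding the point `x` to the codebook `α`. -/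
theorem distortion_insert_add_le {r b : ℝ} (hr : 0 < r) (hb : 0 < b) (hb' : b < 1 / 2)
    (P : Measure E) {α : Finset E} (hα : α.Nonempty) (x : E) :
    distortion P r (insert x α) + ENNReal.ofReal ((1 - b) ^ r - b ^ r) *
      ENNReal.ofReal (Metric.infDist x (α : Set E)) ^ r *
        P (Metric.closedBall x (b * Metric.infDist x (α : Set E))) ≤ distortion P r α := by
  set ρ := Metric.infDist x (α : Set E) with hρ
  have hρ0 : 0 ≤ ρ := Metric.infDist_nonneg
  have hc : 0 ≤ (1 - b) ^ r - b ^ r :=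
    sub_nonneg.2 (Real.rpow_le_rpow hb.le (by linarith) hr.le)
  unfold distortion
  rw [← setLIntegral_const, ← lintegral_indicator Metric.isClosed_closedBall.measurableSet,
    ← lintegral_add_right _
      (measurable_const.indicator Metric.isClosed_closedBall.measurableSet)]
  refine lintegral_mono fun z => ?_
  by_cases hz : z ∈ Metric.closedBall x (b * ρ)
  · rw [Set.indicator_of_mem hz]
    have hz' : dist z x ≤ b * ρ := hz
    have h1 : Metric.infDist z (insert x α : Finset E) ≤ b * ρ :=
      (Metric.infDist_le_dist_of_mem (by simp)).trans hz'
    have h2 : (1 - b) * ρ ≤ Metric.infDist z (α : Set E) := by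
      have : ρ ≤ Metric.infDist z (α : Set E) + dist x z := Metric.infDist_le_infDist_add_dist
      rw [dist_comm] at this
      linarith
    calc _ ≤ ENNReal.ofReal (b * ρ) ^ r +
          ENNReal.ofReal ((1 - b) ^ r - b ^ r) * ENNReal.ofReal ρ ^ r := by gcongr
      _ = ENNReal.ofReal ((1 - b) * ρ) ^ r := by
          have hb1 : 0 ≤ 1 - b := by linarith
          rw [ENNReal.ofReal_rpow_of_nonneg (by positivity) hr.le,
            ENNReal.ofReal_rpow_of_nonneg (by positivity) hr.le,
            ENNReal.ofReal_rpow_of_nonneg (by positivity) hr.le, ← ENNReal.ofReal_mul hc,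
            ← ENNReal.ofReal_add (by positivity) (by positivity), Real.mul_rpow hb.le hρ0,
            Real.mul_rpow hb1 hρ0]
          congr 1
          ring
      _ ≤ _ := by gcongr
  · rw [Set.indicator_of_notMem hz, add_zero]
    gcongr
    exact Metric.infDist_le_infDist_of_subset (by simp) (by simpa using hα)

variable [FiniteDimensional ℝ E] [Nontrivial E]

theorem tendsto_distortion_zero (vol : Measure E) [vol.IsAddHaarMeasure] {P : Measure E}
    [IsFiniteMeasure P] {r η : ℝ} (hr : 0 < r) (hη : 0 < η)
    (hmom : ∫⁻ x, ‖x‖ₑ ^ (r + η) ∂P < ∞) {α : ℕ → Finset E} (hα : IsOptimalSequence P r α) :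
    Tendsto (fun n => distortion P r (α n)) atTop (nhds 0) := by
  obtain ⟨K, hK, h⟩ := exists_distortion_le vol P hr hη hmom
  have hd : (0 : ℝ) < Module.finrank ℝ E := by exact_mod_cast Module.finrank_pos (R := ℝ) (M := E)
  have hlim : Tendsto (fun n : ℕ => ENNReal.ofReal
      (K * (n : ℝ) ^ (-(r / (Module.finrank ℝ E : ℝ))))) atTop (nhds 0) := by
    have h1 := ((tendsto_rpow_neg_atTop (div_pos hr hd)).comp
      tendsto_natCast_atTop_atTop).const_mul K
    rw [mul_zero] at h1
    simpa using ENNReal.tendsto_ofReal h1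
  refine tendsto_of_tendsto_of_tendsto_of_le_of_le' tendsto_const_nhds hlim
    (Eventually.of_forall fun _ => zero_le) ?_
  filter_upwards [eventually_ge_atTop 1] with n hn
  obtain ⟨β, hne, hc, hβ⟩ := h n hn
  exact (hα.distortion_le hr hn hne hc).trans hβ

-- If `d(x, α n) ≥ ε`, the whole ball `B(x, ε/2)` stays at distance at least `ε/2` from `α n`, which
-- keeps the distortion above a positive constant.
omit [NormedSpace ℝ E] [FiniteDimensional ℝ E] [Nontrivial E] in
theorem tendsto_infDist_of_mem_support {P : Measure E} {r : ℝ} (hr : 0 < r) {α : ℕ → Finset E}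
    (hlim : Tendsto (fun n => distortion P r (α n)) atTop (nhds 0)) {x : E}
    (hx : x ∈ P.support) :
    Tendsto (fun n => Metric.infDist x (α n : Set E)) atTop (nhds 0) := by
  rw [Metric.tendsto_nhds]
  intro ε hε
  have hpos : 0 < ENNReal.ofReal (ε / 2) ^ r * P (Metric.ball x (ε / 2)) := by
    have h1 := (Measure.mem_support_iff_forall x).1 hx _ (Metric.ball_mem_nhds x (half_pos hε))
    have h2 : 0 < ENNReal.ofReal (ε / 2) ^ r :=
      ENNReal.rpow_pos (by simpa using hε) ENNReal.ofReal_ne_top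
    exact ENNReal.mul_pos h2.ne' h1.ne'
  filter_upwards [hlim.eventually (gt_mem_nhds hpos)] with n hn
  rw [Real.dist_eq, sub_zero, abs_of_nonneg Metric.infDist_nonneg]
  by_contra! hcon
  refine hn.not_ge ?_
  rw [← setLIntegral_const]
  refine le_trans (setLIntegral_mono' measurableSet_ball fun z hz => ?_)
    (setLIntegral_le_lintegral _ _)
  gcongr
  have h1 : Metric.infDist x (α n : Set E) ≤ Metric.infDist z (α n : Set E) + dist x z :=
    Metric.infDist_le_infDist_add_dist
  have h2 : dist z x < ε / 2 := hz
  rw [dist_comm] at h2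
  linarith

/-- The distortion increments of an optimal sequence are `O(n^{-(1 + r/d)})`. -/
theorem exists_distortion_le_succ_add (vol : Measure E) [vol.IsAddHaarMeasure] {P : Measure E}
    [IsProbabilityMeasure P] (hPvol : P ≪ vol) {r η : ℝ} (hr : 0 < r) (hη : 0 < η)
    (hmom : ∫⁻ x, ‖x‖ₑ ^ (r + η) ∂P < ∞) {α : ℕ → Finset E} (hα : IsOptimalSequence P r α) :
    ∃ K : ℝ, 0 < K ∧ ∀ᶠ n : ℕ in atTop, distortion P r (α n) ≤ distortion P r (α (n + 1)) +
      ENNReal.ofReal (K * (n : ℝ) ^ (-(1 + r / (Module.finrank ℝ E : ℝ)))) := by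
  classical
  have hlim := tendsto_distortion_zero vol hr hη hmom hα
  -- As `P` has no atoms, its support contains two distinct points. Codebook points eventually
  -- approach each of them, which supplies the two codebook points in a fixed ball.
  have hsupp : ∀ᵐ x ∂P, x ∈ P.support := Measure.support_mem_ae
  obtain ⟨x₁, hx₁⟩ := hsupp.exists
  have hne₁ : ∀ᵐ x ∂P, x ≠ x₁ := by
    rw [ae_iff]
    simpa using hPvol (measure_singleton x₁)
  obtain ⟨x₂, hx₂, hne⟩ := (hsupp.and hne₁).exists
  have hε : 0 < dist x₁ x₂ / 2 := half_pos (dist_pos.2 hne.symm)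
  have hev : ∀ x ∈ P.support, ∀ᶠ n in atTop,
      ∃ a ∈ α n, dist x a < dist x₁ x₂ / 2 := by
    intro x hx
    filter_upwards [(tendsto_infDist_of_mem_support hr hlim hx).eventually (gt_mem_nhds hε),
      eventually_ge_atTop 1] with n hn hn1
    obtain ⟨a, ha, hd⟩ := (Metric.infDist_lt_iff (by simpa using (hα n hn1).1)).1 hn
    exact ⟨a, ha, hd⟩
  obtain ⟨K₀, hK₀, hPierce⟩ := exists_distortion_le vol P hr hη hmom
  obtain ⟨T, hT, herase⟩ := exists_distortion_erase_le vol P hr hη hmom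
    (R := ‖x₁‖ + ‖x₂‖ + dist x₁ x₂ / 2) (by positivity)
  have hd : (0 : ℝ) < Module.finrank ℝ E := by exact_mod_cast Module.finrank_pos (R := ℝ) (M := E)
  set d : ℝ := (Module.finrank ℝ E : ℝ)
  set τ := T.toReal with hτ
  have hτ0 : 0 ≤ τ := ENNReal.toReal_nonneg
  refine ⟨2 ^ r * (K₀ * τ + τ ^ (1 + r / d)) + 1, by positivity, ?_⟩
  have hev' := (tendsto_add_atTop_nat 1).eventually ((hev x₁ hx₁).and (hev x₂ hx₂))
  filter_upwards [hev', eventually_ge_atTop 1] with n ⟨⟨u₁, hu₁, hd₁⟩, ⟨u₂, hu₂, hd₂⟩⟩ hn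
  -- With at most `n` points, `α (n + 1)` already competes at level `n` and the increment is not
  -- positive.
  by_cases hcard : (α (n + 1)).card ≤ n
  · exact (hα.distortion_le hr hn (hα (n + 1) (by omega)).1 hcard).trans le_self_add
  have hcard' : (α (n + 1)).card = n + 1 := by
    have := (hα (n + 1) (by omega)).2.1
    omega
  have hu : u₁ ≠ u₂ := by
    rintro rfl
    have := dist_triangle_right x₁ x₂ u₁
    linarith
  have hnorm : ∀ x u : E, dist x u < dist x₁ x₂ / 2 → ‖u‖ ≤ ‖x‖ + dist x₁ x₂ / 2 := by
    intro x u h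
    have : ‖u‖ ≤ ‖x‖ + ‖x - u‖ := by simpa using norm_sub_le x (x - u)
    rw [dist_eq_norm] at h
    linarith
  have hn0 : (0 : ℝ) < n := by exact_mod_cast hn
  set N : ℝ := (n : ℝ) + 1 with hN
  have hNpos : 0 < N := by positivity
  obtain ⟨a, ha, hle⟩ := herase (α (n + 1)) (hα (n + 1) (by omega)).1 (fun a _ => by
      by_cases h : u₁ = a
      · exact ⟨u₂, hu₂, h ▸ hu.symm, by linarith [hnorm _ _ hd₂, norm_nonneg x₁]⟩
      · exact ⟨u₁, hu₁, h, by linarith [hnorm _ _ hd₁, norm_nonneg x₂]⟩)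
    (ENNReal.ofReal (K₀ * N ^ (-(r / d)))) (by simp; positivity) ENNReal.ofReal_ne_top (by
      obtain ⟨β, hβ, hc, hle⟩ := hPierce (n + 1) (by omega)
      refine (hα.distortion_le hr (by omega) hβ hc).trans (hle.trans_eq ?_)
      rw [hN]; push_cast; rfl)
  have hTN : T / ((α (n + 1)).card : ℝ≥0∞) = ENNReal.ofReal (τ / N) := by
    rw [hcard', ENNReal.ofReal_div_of_pos hNpos, ENNReal.ofReal_toReal hT, hN]
    congr 1
    rw [← Nat.cast_succ, ENNReal.ofReal_natCast]
  have hne' : ((α (n + 1)).erase a).Nonempty := by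
    rw [← Finset.card_pos, Finset.card_erase_of_mem ha]
    omega
  refine (hα.distortion_le hr hn hne' (by rw [Finset.card_erase_of_mem ha]; omega)).trans
    (hle.trans ?_)
  gcongr
  have h2 : (2 : ℝ≥0∞) ^ r = ENNReal.ofReal (2 ^ r) := by
    rw [← ENNReal.ofReal_rpow_of_pos two_pos]; norm_num
  rw [hTN, ENNReal.ofReal_rpow_of_nonneg (by positivity) (by positivity), h2,
    ← ENNReal.ofReal_mul (by positivity), ← ENNReal.ofReal_add (by positivity) (by positivity),
    ← ENNReal.ofReal_mul (by positivity)]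
  refine ENNReal.ofReal_le_ofReal ?_
  have h3 : K₀ * N ^ (-(r / d)) * (τ / N) = K₀ * τ * N ^ (-(1 + r / d)) := by
    rw [neg_add, Real.rpow_add hNpos, Real.rpow_neg_one]
    field_simp
  have h4 : (τ / N) ^ (1 + r / d) = τ ^ (1 + r / d) * N ^ (-(1 + r / d)) := by
    rw [Real.div_rpow hτ0 hNpos.le, Real.rpow_neg hNpos.le, div_eq_mul_inv]
  calc _ = 2 ^ r * (K₀ * τ + τ ^ (1 + r / d)) * N ^ (-(1 + r / d)) := by rw [h3, h4]; ring
    _ ≤ (2 ^ r * (K₀ * τ + τ ^ (1 + r / d)) + 1) * (n : ℝ) ^ (-(1 + r / d)) := by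
        have : N ^ (-(1 + r / d)) ≤ (n : ℝ) ^ (-(1 + r / d)) :=
          Real.rpow_le_rpow_of_nonpos hn0 (by linarith) (by
            have : 0 < 1 + r / d := by positivity
            linarith)
        gcongr
        linarith

/-- The pointwise bound of `d(x, α_n)` by the ratio of the volume to the probability of the ball
`B(x, b d(x, α_n))`. -/
theorem infDist_rpow_le_of_distortion_le (vol : Measure E) [vol.IsAddHaarMeasure] {P : Measure E}
    [IsFiniteMeasure P] {r s b K : ℝ} (hr : 0 < r) (hs : 0 < s) (hb : 0 < b) (hb' : b < 1 / 2)
    (hK : 0 < K) {α : ℕ → Finset E} (hα : IsOptimalSequence P r α) {n : ℕ} (hn : 1 ≤ n)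
    (hfin : distortion P r (α (n + 1)) ≠ ∞)
    (hle : distortion P r (α n) ≤ distortion P r (α (n + 1)) +
      ENNReal.ofReal (K * (n : ℝ) ^ (-(1 + r / (Module.finrank ℝ E : ℝ))))) {x : E}
    (hx : 0 < Metric.infDist x (α n : Set E)) :
    (n : ℝ≥0∞) ^ (s / (Module.finrank ℝ E : ℝ)) *
        ENNReal.ofReal (Metric.infDist x (α n : Set E)) ^ s ≤
      ENNReal.ofReal ((K / (((1 - b) ^ r - b ^ r) * b ^ (Module.finrank ℝ E) *
        (vol (Metric.ball (0 : E) 1)).toReal)) ^ (s / (Module.finrank ℝ E + r))) *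
      (vol (Metric.closedBall x (b * Metric.infDist x (α n : Set E))) /
        P (Metric.closedBall x (b * Metric.infDist x (α n : Set E)))) ^
          (s / (Module.finrank ℝ E + r)) := by
  classical
  have hgain := distortion_insert_add_le hr hb hb' P (hα n hn).1 x
  have hopt : distortion P r (α (n + 1)) ≤ distortion P r (insert x (α n)) :=
    hα.distortion_le hr (by omega) (Finset.insert_nonempty _ _)
      ((Finset.card_insert_le _ _).trans (by simpa using (hα n hn).2.1))
  set ρ := Metric.infDist x (α n : Set E) with hρ
  set B := Metric.closedBall x (b * ρ) with hB
  have hn0 : (0 : ℝ) < n := by exact_mod_cast hn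
  have hdpos : (0 : ℝ) < Module.finrank ℝ E := by
    exact_mod_cast Module.finrank_pos (R := ℝ) (M := E)
  set d := Module.finrank ℝ E with hd
  have hc : 0 < (1 - b) ^ r - b ^ r :=
    sub_pos.2 (Real.rpow_lt_rpow hb.le (by linarith) hr)
  set c := (1 - b) ^ r - b ^ r with hcdef
  have hv0 : vol (Metric.ball (0 : E) 1) ≠ 0 := (Metric.measure_ball_pos vol 0 one_pos).ne'
  have hvt : vol (Metric.ball (0 : E) 1) ≠ ∞ := measure_ball_lt_top.ne
  set v := (vol (Metric.ball (0 : E) 1)).toReal with hv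
  have hvpos : 0 < v := ENNReal.toReal_pos hv0 hvt
  have hvolB : vol B = ENNReal.ofReal ((b * ρ) ^ d * v) := by
    rw [hB, Measure.addHaar_closedBall vol x (by positivity), ENNReal.ofReal_mul (by positivity),
      hv, ENNReal.ofReal_toReal hvt]
  set m : ℝ := K * (n : ℝ) ^ (-(1 + r / (d : ℝ))) with hm
  have hmpos : 0 < m := by positivity
  -- `insert x (α n)` competes with `α (n + 1)`; the finite distortion of the latter is cancelled.
  have hkey : ENNReal.ofReal c * ENNReal.ofReal ρ ^ r * P B ≤ ENNReal.ofReal m := by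
    refine (ENNReal.add_le_add_iff_left hfin).1 ?_
    calc _ ≤ distortion P r (insert x (α n)) + ENNReal.ofReal c * ENNReal.ofReal ρ ^ r * P B := by
          gcongr
      _ ≤ _ := hgain.trans hle
  set k : ℝ := m / (c * b ^ d * v) with hk
  have hkpos : 0 < k := by positivity
  have hmain : ENNReal.ofReal (ρ ^ ((d : ℝ) + r)) ≤ ENNReal.ofReal k * (vol B / P B) := by
    rw [← mul_div_assoc, hvolB, ← ENNReal.ofReal_mul hkpos.le]
    have h0 : 0 < k * ((b * ρ) ^ d * v) := by positivity
    -- Nonzero finite volume makes this valid even when `P B = 0`, where the quotient is `∞`.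
    rw [ENNReal.le_div_iff_mul_le (Or.inr (by simpa using h0)) (Or.inr ENNReal.ofReal_ne_top)]
    calc ENNReal.ofReal (ρ ^ ((d : ℝ) + r)) * P B
        = ENNReal.ofReal (ρ ^ d / c) * (ENNReal.ofReal c * ENNReal.ofReal ρ ^ r * P B) := by
          rw [ENNReal.ofReal_rpow_of_pos hx, ← mul_assoc, ← ENNReal.ofReal_mul hc.le,
            ← ENNReal.ofReal_mul (by positivity), Real.rpow_add hx, Real.rpow_natCast]
          congr 2
          field_simp
      _ ≤ ENNReal.ofReal (ρ ^ d / c) * ENNReal.ofReal m := by gcongr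
      _ = _ := by
          rw [← ENNReal.ofReal_mul (by positivity), hk, mul_pow]
          congr 1
          field_simp
  have hp : 0 < s / ((d : ℝ) + r) := by positivity
  have hpow := ENNReal.rpow_le_rpow hmain hp.le
  rw [ENNReal.mul_rpow_of_nonneg _ _ hp.le, ENNReal.ofReal_rpow_of_pos (by positivity),
    ← Real.rpow_mul hx.le, mul_div_cancel₀ _ (by positivity : (d : ℝ) + r ≠ 0)] at hpow
  rw [ENNReal.ofReal_rpow_of_pos hx]
  have hns : (n : ℝ≥0∞) ^ (s / (d : ℝ)) = ENNReal.ofReal ((n : ℝ) ^ (s / (d : ℝ))) := by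
    rw [← ENNReal.ofReal_rpow_of_pos hn0, ENNReal.ofReal_natCast]
  calc _ ≤ (n : ℝ≥0∞) ^ (s / (d : ℝ)) * (ENNReal.ofReal k ^ (s / ((d : ℝ) + r)) *
        (vol B / P B) ^ (s / ((d : ℝ) + r))) := by gcongr
    _ = _ := by
      rw [← mul_assoc, hns, ENNReal.ofReal_rpow_of_pos hkpos,
        ← ENNReal.ofReal_mul (by positivity)]
      congr 2
      have h1 : k = K / (c * b ^ d * v) * (n : ℝ) ^ (-(1 + r / (d : ℝ))) := by
        rw [hk, hm]; ring
      rw [h1, Real.mul_rpow (by positivity) (by positivity), ← Real.rpow_mul hn0.le,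
        mul_left_comm, ← Real.rpow_add hn0]
      have h2 : s / (d : ℝ) + -(1 + r / (d : ℝ)) * (s / ((d : ℝ) + r)) = 0 := by
        field_simp
        ring
      rw [h2, Real.rpow_zero, mul_one]

end Optimal

/-! ### Dilated laws and Voronoi quantization -/

section Dilation

variable {E : Type*} [NormedAddCommGroup E] [NormedSpace ℝ E] [FiniteDimensional ℝ E]
  [MeasurableSpace E] [BorelSpace E]

omit [FiniteDimensional ℝ E] in
theorem measurable_dilation (θ : ℝ) (μ : E) : Measurable fun x : E => θ⁻¹ • (x - μ) + μ :=
  ((measurable_id.sub_const μ).const_smul θ⁻¹).add_const μ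

/-- The density of the dilated law. -/
theorem lintegral_dilatedLaw (vol : Measure E) [vol.IsAddHaarMeasure] {f : E → ℝ≥0}
    (hf : Measurable f) {θ : ℝ} (hθ : 0 < θ) (μ : E) {g : E → ℝ≥0∞} (hg : Measurable g) :
    ∫⁻ x, g x ∂(dilatedLaw θ μ (vol.withDensity fun x => (f x : ℝ≥0∞))) =
      ENNReal.ofReal (θ ^ (Module.finrank ℝ E)) *
        ∫⁻ x, (f (μ + θ • (x - μ)) : ℝ≥0∞) * g x ∂vol := by
  have hT := measurable_dilation (E := E) θ μ
  have hS : Measurable fun x : E => μ + θ • (x - μ) :=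
    ((measurable_id.sub_const μ).const_smul θ).const_add μ
  set h : E → ℝ≥0∞ := fun y => (f (μ + θ • (y - μ)) : ℝ≥0∞) * g y with hh
  have hhm : Measurable h := (hf.comp hS).coe_nnreal_ennreal.mul hg
  rw [dilatedLaw, lintegral_map hg hT,
    lintegral_withDensity_eq_lintegral_mul _ hf.coe_nnreal_ennreal
      (g := fun x => g (θ⁻¹ • (x - μ) + μ)) (hg.comp hT)]
  calc _ = ∫⁻ x, h (θ⁻¹ • (x - μ) + μ) ∂vol := by
        refine lintegral_congr fun x => ?_
        simp [hh, smul_smul, hθ.ne']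
    _ = ∫⁻ x, h (θ⁻¹ • x + μ) ∂vol :=
        lintegral_sub_right_eq_self (fun x => h (θ⁻¹ • x + μ)) μ
    _ = ∫⁻ y, h (y + μ) ∂(vol.map fun x => θ⁻¹ • x) :=
        (lintegral_map (hhm.comp (measurable_id.add_const μ)) (measurable_const_smul θ⁻¹)).symm
    _ = ENNReal.ofReal (θ ^ (Module.finrank ℝ E)) * ∫⁻ y, h (y + μ) ∂vol := by
        rw [Measure.map_addHaar_smul vol (inv_ne_zero hθ.ne'), lintegral_smul_measure, inv_pow,
          inv_inv, abs_of_pos (by positivity), smul_eq_mul]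
    _ = _ := by rw [lintegral_add_right_eq_self]

-- The map `x ↦ θ⁻¹ (x - μ) + μ` carries the dilated codebook back to `α` and divides distances by
-- `θ`.
omit [FiniteDimensional ℝ E] [BorelSpace E] in
theorem norm_sub_voronoiQuantization_le {Ω : Type*} {θ : ℝ} (hθ : 0 < θ) (μ : E)
    {α : Finset E} (hα : α.Nonempty) {V : E → Set E}
    (hV : IsVoronoiPartition (dilate θ μ α) V) (X : Ω → E) (ω : Ω) :
    ‖X ω - voronoiQuantization (dilate θ μ α) V X ω‖ ≤
      θ * Metric.infDist (θ⁻¹ • (X ω - μ) + μ) (α : Set E) := by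
  classical
  obtain ⟨a, ha, hx⟩ := hV.covers (X ω)
  have hq : voronoiQuantization (dilate θ μ α) V X ω = a := by
    unfold voronoiQuantization
    rw [Finset.sum_eq_single_of_mem a ha]
    · exact Set.indicator_of_mem (by exact hx) _
    · intro a' ha' hne
      refine Set.indicator_of_notMem (fun hx' => ?_) _
      exact Set.disjoint_left.1 (hV.disjoint a' ha' a ha hne) hx' hx
  obtain ⟨c, hc, hdist⟩ := α.finite_toSet.isCompact.exists_infDist_eq_dist (by simpa using hα)
    (θ⁻¹ • (X ω - μ) + μ)
  rw [hq, hdist]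
  refine (hV.nearest a ha (X ω) hx (μ + θ • (c - μ)) ?_).trans_eq ?_
  · unfold dilate
    exact Finset.mem_image_of_mem _ hc
  · rw [dist_eq_norm, ← abs_of_pos hθ, ← Real.norm_eq_abs, ← norm_smul, Real.norm_eq_abs,
      abs_of_pos hθ]
    congr 1
    simp only [smul_sub, smul_add, smul_inv_smul₀ hθ.ne']
    abel

omit [FiniteDimensional ℝ E] in
theorem lintegral_norm_sub_voronoiQuantization_le {Ω : Type*} [MeasurableSpace Ω]
    {Pr : Measure Ω} {X : Ω → E} {P : Measure E} (hX : HasLaw X P Pr) {θ s : ℝ} (hθ : 0 < θ)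
    (hs : 0 < s) (μ : E) {α : Finset E} (hα : α.Nonempty) {V : E → Set E}
    (hV : IsVoronoiPartition (dilate θ μ α) V) :
    ∫⁻ ω, ‖X ω - voronoiQuantization (dilate θ μ α) V X ω‖ₑ ^ s ∂Pr ≤
      ENNReal.ofReal (θ ^ s) *
        ∫⁻ y, ENNReal.ofReal (Metric.infDist y (α : Set E)) ^ s ∂(dilatedLaw θ μ P) := by
  have hT := measurable_dilation (E := E) θ μ
  have hg : Measurable fun y : E => ENNReal.ofReal (Metric.infDist y (α : Set E)) ^ s :=
    (Metric.continuous_infDist_pt _).measurable.ennreal_ofReal.pow_const s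
  rw [dilatedLaw, lintegral_map hg hT, ← hX.lintegral_comp
      (f := fun x => ENNReal.ofReal (Metric.infDist (θ⁻¹ • (x - μ) + μ) (α : Set E)) ^ s)
      (hg.comp hT).aemeasurable,
    ← lintegral_const_mul' _ _ ENNReal.ofReal_ne_top]
  refine lintegral_mono fun ω => ?_
  rw [← ENNReal.ofReal_rpow_of_pos hθ, ← ENNReal.mul_rpow_of_nonneg _ _ hs.le,
    ← ENNReal.ofReal_mul hθ.le, ← ofReal_norm]
  gcongr
  exact norm_sub_voronoiQuantization_le hθ μ hα hV X ω

end Dilation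

/-! ### Lebesgue differentiation -/

section Differentiation

variable {E : Type*} [NormedAddCommGroup E] [NormedSpace ℝ E] [FiniteDimensional ℝ E]
  [MeasurableSpace E] [BorelSpace E]

/-- Lebesgue differentiation for the ratio of the volume to the probability of shrinking balls. -/
theorem ae_tendsto_volume_div (vol : Measure E) [vol.IsAddHaarMeasure] {f : E → ℝ≥0}
    (hf : Measurable f) [IsFiniteMeasure (vol.withDensity fun x => (f x : ℝ≥0∞))] :
    ∀ᵐ x ∂vol, ∀ δ : ℕ → ℝ, Tendsto δ atTop (nhdsWithin 0 (Set.Ioi 0)) →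
      Tendsto (fun n => vol (Metric.closedBall x (δ n)) /
        (vol.withDensity fun x => (f x : ℝ≥0∞)) (Metric.closedBall x (δ n)))
        atTop (nhds ((f x : ℝ≥0∞)⁻¹)) := by
  set P := vol.withDensity fun x => (f x : ℝ≥0∞) with hP
  filter_upwards [(IsUnifLocDoublingMeasure.vitaliFamily vol 1).ae_tendsto_rnDeriv P,
    Measure.rnDeriv_withDensity vol hf.coe_nnreal_ennreal] with x hx hfx δ hδ
  have hpos : ∀ᶠ n in atTop, 0 < δ n := by
    have := hδ.eventually (eventually_mem_nhdsWithin)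
    simpa using this
  rw [← hP] at hfx
  rw [hfx] at hx
  have hball := IsUnifLocDoublingMeasure.tendsto_closedBall_filterAt vol (K := 1) (x := x)
    (fun _ => x) δ hδ (by
      filter_upwards [hpos] with n hn
      simpa using hn.le)
  refine Tendsto.congr' ?_ ((hx.comp hball).inv)
  filter_upwards [hpos] with n hn
  have h0 : vol (Metric.closedBall x (δ n)) ≠ 0 := (Metric.measure_closedBall_pos vol x hn).ne'
  exact ENNReal.inv_div (Or.inl measure_closedBall_lt_top.ne) (Or.inl h0)

end Differentiation

/-! ### Passage to the limit -/

section Limsup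

variable {E : Type*} [NormedAddCommGroup E] [NormedSpace ℝ E] [FiniteDimensional ℝ E]
  [MeasurableSpace E] [BorelSpace E] [Nontrivial E]

/-- Differentiation needs positive radii tending to `0`: positivity holds off the countable union of
the codebooks, convergence on the support of `P`. -/
theorem ae_tendsto_volume_div_infDist (vol : Measure E) [vol.IsAddHaarMeasure] {f : E → ℝ≥0}
    (hf : Measurable f) {P : Measure E} [IsFiniteMeasure P]
    (hP : P = vol.withDensity fun x => (f x : ℝ≥0∞)) {r b : ℝ} (hr : 0 < r) (hb : 0 < b)
    {α : ℕ → Finset E} (hα : IsOptimalSequence P r α)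
    (hlim : Tendsto (fun n => distortion P r (α n)) atTop (nhds 0)) :
    ∀ᵐ x ∂P, (∀ n, 1 ≤ n → 0 < Metric.infDist x (α n : Set E)) ∧
      Tendsto (fun n => vol (Metric.closedBall x (b * Metric.infDist x (α n : Set E))) /
        P (Metric.closedBall x (b * Metric.infDist x (α n : Set E))))
        atTop (nhds ((f x : ℝ≥0∞)⁻¹)) := by
  have hPvol : P ≪ vol := hP ▸ withDensity_absolutelyContinuous _ _
  have hdiff : ∀ᵐ x ∂P, ∀ δ : ℕ → ℝ, Tendsto δ atTop (nhdsWithin 0 (Set.Ioi 0)) →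
      Tendsto (fun n => vol (Metric.closedBall x (δ n)) / P (Metric.closedBall x (δ n)))
        atTop (nhds ((f x : ℝ≥0∞)⁻¹)) := by
    refine hPvol.ae_le ?_
    subst hP
    exact ae_tendsto_volume_div vol hf
  have hnot : ∀ᵐ x ∂P, ∀ n, x ∉ α n := by
    rw [ae_all_iff]
    intro n
    refine hPvol.ae_le ?_
    exact measure_eq_zero_iff_ae_notMem.1 ((α n).finite_toSet.measure_zero vol)
  have hsupp : ∀ᵐ x ∂P, x ∈ P.support := Measure.support_mem_ae
  filter_upwards [hdiff, hnot, hsupp] with x h1 h2 h3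
  have hpos : ∀ n, 1 ≤ n → 0 < Metric.infDist x (α n : Set E) := fun n hn =>
    ((α n).finite_toSet.isClosed.notMem_iff_infDist_pos (by simpa using (hα n hn).1)).1
      (by simpa using h2 n)
  refine ⟨hpos, h1 _ ?_⟩
  rw [tendsto_nhdsWithin_iff]
  refine ⟨by simpa using (tendsto_infDist_of_mem_support hr hlim h3).const_mul b, ?_⟩
  filter_upwards [eventually_ge_atTop 1] with n hn
  exact mul_pos hb (hpos n hn)

/-- The limiting bound for the distortion of an `L^r`-optimal sequence with respect to another
law `ν ≪ P`. -/
theorem limsup_lintegral_infDist_le (vol : Measure E) [vol.IsAddHaarMeasure] {f : E → ℝ≥0}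
    (hf : Measurable f) {P : Measure E} [IsProbabilityMeasure P]
    (hP : P = vol.withDensity fun x => (f x : ℝ≥0∞)) {r s b K : ℝ} (hr : 0 < r) (hs : 0 < s)
    (hb : 0 < b) (hb' : b < 1 / 2) (hK : 0 < K)
    {α : ℕ → Finset E} (hα : IsOptimalSequence P r α)
    (hlim : Tendsto (fun n => distortion P r (α n)) atTop (nhds 0))
    (hincr : ∀ᶠ n : ℕ in atTop, distortion P r (α n) ≤ distortion P r (α (n + 1)) +
      ENNReal.ofReal (K * (n : ℝ) ^ (-(1 + r / (Module.finrank ℝ E : ℝ)))))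
    {ν : Measure E} (hν : ν ≪ P)
    (hψ : ∫⁻ x, maximalFunction vol P α b x ^ (s / (Module.finrank ℝ E + r)) ∂ν < ∞) :
    limsup (fun n : ℕ => (n : ℝ≥0∞) ^ (s / (Module.finrank ℝ E : ℝ)) *
        ∫⁻ x, ENNReal.ofReal (Metric.infDist x (α n : Set E)) ^ s ∂ν) atTop ≤
      ENNReal.ofReal ((K / (((1 - b) ^ r - b ^ r) * b ^ (Module.finrank ℝ E) *
        (vol (Metric.ball (0 : E) 1)).toReal)) ^ (s / (Module.finrank ℝ E + r))) *
        ∫⁻ x, (f x : ℝ≥0∞) ^ (-(s / (Module.finrank ℝ E + r))) ∂ν ∧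
    ∫⁻ x, (f x : ℝ≥0∞) ^ (-(s / (Module.finrank ℝ E + r))) ∂ν < ∞ := by
  set p : ℝ := s / (Module.finrank ℝ E + r) with hp
  have hp0 : 0 < p := by positivity
  set c : ℝ≥0∞ := ENNReal.ofReal ((K / (((1 - b) ^ r - b ^ r) * b ^ (Module.finrank ℝ E) *
        (vol (Metric.ball (0 : E) 1)).toReal)) ^ p) with hc
  set q : ℕ → E → ℝ≥0∞ := fun n x =>
    vol (Metric.closedBall x (b * Metric.infDist x (α n : Set E))) /
        P (Metric.closedBall x (b * Metric.infDist x (α n : Set E))) with hq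
  have hae := hν.ae_le (ae_tendsto_volume_div_infDist vol hf hP hr hb hα hlim)
  have hqlim : ∀ᵐ x ∂ν, Tendsto (fun n => q n x ^ p) atTop (nhds ((f x : ℝ≥0∞) ^ (-p))) := by
    filter_upwards [hae] with x hx
    rw [ENNReal.rpow_neg, ← ENNReal.inv_rpow]
    exact (ENNReal.continuous_rpow_const.tendsto _).comp hx.2
  have hqψ : ∀ n, 1 ≤ n → ∀ x, q n x ^ p ≤ maximalFunction vol P α b x ^ p := by
    intro n hn x
    gcongr
    exact le_iSup₂_of_le n hn le_rfl
  constructor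
  swap
  -- Finiteness of the limiting integral: `f^{-p}` is a limit of quantities bounded by `ψ_b^p`.
  · refine lt_of_le_of_lt (lintegral_mono_ae ?_) hψ
    filter_upwards [hqlim] with x hx
    refine le_of_tendsto hx ?_
    filter_upwards [eventually_ge_atTop 1] with n hn using hqψ n hn x
  have hfin : ∀ᶠ n in atTop, distortion P r (α n) < ∞ :=
    hlim.eventually (gt_mem_nhds ENNReal.zero_lt_top)
  obtain ⟨n₀, hn₀⟩ := eventually_atTop.1 (((hincr.and
    ((tendsto_add_atTop_nat 1).eventually hfin)).and (eventually_ge_atTop 1)))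
  set F : ℕ → E → ℝ≥0∞ := fun n x => (n : ℝ≥0∞) ^ (s / (Module.finrank ℝ E : ℝ)) *
    ENNReal.ofReal (Metric.infDist x (α n : Set E)) ^ s with hF
  have hFm : ∀ n, Measurable (F n) := fun n =>
    (((Metric.continuous_infDist_pt _).measurable.ennreal_ofReal.pow_const s)).const_mul _
  have hFq : ∀ n, n₀ ≤ n → ∀ᵐ x ∂ν, F n x ≤ c * q n x ^ p := by
    intro n hn
    obtain ⟨⟨h1, h2⟩, h3⟩ := hn₀ n hn
    filter_upwards [hae] with x hx
    exact infDist_rpow_le_of_distortion_le vol hr hs hb hb' hK hα h3 h2.ne h1 (hx.1 n h3)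
  have hF_int : ∀ n : ℕ, (n : ℝ≥0∞) ^ (s / (Module.finrank ℝ E : ℝ)) *
      ∫⁻ x, ENNReal.ofReal (Metric.infDist x (α n : Set E)) ^ s ∂ν = ∫⁻ x, F n x ∂ν := by
    intro n
    exact (lintegral_const_mul' _ _ (ENNReal.rpow_ne_top_of_nonneg (by positivity)
      (ENNReal.natCast_ne_top n))).symm
  simp only [hF_int]
  -- Reverse Fatou needs domination for every index, whereas the increment bound holds only from
  -- `n₀` on.
  rw [← limsup_nat_add _ n₀, ← lintegral_const_mul' _ _ ENNReal.ofReal_ne_top]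
  refine (limsup_lintegral_le (f := fun n => F (n + n₀))
    (fun x => c * maximalFunction vol P α b x ^ p) (fun n => hFm _) (fun n => ?_) ?_).trans ?_
  · filter_upwards [hFq (n + n₀) (by omega)] with x hx
    exact hx.trans (mul_le_mul_right (hqψ _ (hn₀ (n + n₀) (by omega)).2 x) c)
  · rw [lintegral_const_mul' _ _ ENNReal.ofReal_ne_top]
    exact ENNReal.mul_ne_top ENNReal.ofReal_ne_top hψ.ne
  · refine lintegral_mono_ae ?_
    have hall : ∀ᵐ x ∂ν, ∀ n, F (n + n₀) x ≤ c * q (n + n₀) x ^ p :=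
      ae_all_iff.2 fun n => hFq _ (by omega)
    filter_upwards [hall, hqlim] with x hx hx'
    have ht : Tendsto (fun n => c * q (n + n₀) x ^ p) atTop (nhds (c * (f x : ℝ≥0∞) ^ (-p))) :=
      ENNReal.Tendsto.const_mul ((tendsto_add_atTop_iff_nat n₀).2 hx') (Or.inr ENNReal.ofReal_ne_top)
    rw [← ht.limsup_eq]
    exact limsup_le_limsup (Eventually.of_forall hx)

end Limsup

end Quantization

/-! ### Assembly with a uniform constant -/

theorem theorem3
    {E : Type*} [NormedAddCommGroup E] [NormedSpace ℝ E] [FiniteDimensional ℝ E] [Nontrivial E]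
    [MeasurableSpace E] [BorelSpace E]
    (vol : Measure E) [vol.IsAddHaarMeasure]
    (d : ℕ) (hd : Module.finrank ℝ E = d)
    {Ω : Type*} [MeasurableSpace Ω] (Pr : Measure Ω) [IsProbabilityMeasure Pr]
    (X : Ω → E) (P : Measure E) (hX : HasLaw X P Pr)
    (f : E → ℝ≥0) (hf : Measurable f) (hP : P = vol.withDensity (fun x => (f x : ℝ≥0∞)))
    (r s : ℝ) (hr : 0 < r) (hrs : r < s)
    (hmoment : ∃ η : ℝ, 0 < η ∧ ∫⁻ ω, ‖X ω‖ₑ ^ (r + η) ∂Pr < ∞)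
    (b : ℝ) (hb : 0 < b) (hb' : b < 1 / 2) :
    ∃ C : ℝ, 0 < C ∧
      ∀ (θ : ℝ) (μ : E) (α : ℕ → Finset E), 0 < θ →
        (Quantization.dilatedLaw θ μ P).AbsolutelyContinuous P →
        Quantization.IsOptimalSequence P r α →
        ∫⁻ x, Quantization.maximalFunction vol P α b x ^ (s / (d + r))
          ∂(Quantization.dilatedLaw θ μ P) < ∞ →
        ∀ V : ℕ → E → Set E,
          (∀ n, 1 ≤ n →
            Quantization.IsVoronoiPartition (Quantization.dilate θ μ (α n)) (V n)) →
          limsup (fun n : ℕ => (n : ℝ≥0∞) ^ (s / d) *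
              ∫⁻ ω, ‖X ω - Quantization.voronoiQuantization
                (Quantization.dilate θ μ (α n)) (V n) X ω‖ₑ ^ s ∂Pr) atTop
            ≤ ENNReal.ofReal (θ ^ (s + d) * C) *
                ∫⁻ x, (f (μ + θ • (x - μ)) : ℝ≥0∞) * (f x : ℝ≥0∞) ^ (-(s / (d + r))) ∂vol ∧
          ENNReal.ofReal (θ ^ (s + d) * C) *
              ∫⁻ x, (f (μ + θ • (x - μ)) : ℝ≥0∞) * (f x : ℝ≥0∞) ^ (-(s / (d + r))) ∂vol < ∞ := by
  subst hd
  obtain ⟨η, hη, hmom⟩ := hmoment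
  have hs : 0 < s := hr.trans hrs
  have : IsProbabilityMeasure P := hX.isProbabilityMeasure_iff.1 inferInstance
  have hmomP : ∫⁻ x, ‖x‖ₑ ^ (r + η) ∂P < ∞ := by
    rwa [← hX.lintegral_comp (by fun_prop)]
  have hPvol : P ≪ vol := hP ▸ withDensity_absolutelyContinuous _ _
  -- The constant must precede the choice of `α`, so it is taken from one reference optimal
  -- sequence; without any, the claim is vacuous.
  by_cases hex : ∃ α₀ : ℕ → Finset E, Quantization.IsOptimalSequence P r α₀
  swap
  · exact ⟨1, one_pos, fun θ μ α _ _ hα => absurd ⟨α, hα⟩ hex⟩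
  obtain ⟨α₀, hα₀⟩ := hex
  obtain ⟨K, hK, hincr₀⟩ :=
    Quantization.exists_distortion_le_succ_add vol hPvol hr hη hmomP hα₀
  have hc : 0 < (1 - b) ^ r - b ^ r := sub_pos.2 (Real.rpow_lt_rpow hb.le (by linarith) hr)
  have hv : 0 < (vol (Metric.ball (0 : E) 1)).toReal :=
    ENNReal.toReal_pos (Metric.measure_ball_pos vol 0 one_pos).ne' measure_ball_lt_top.ne
  refine ⟨(K / (((1 - b) ^ r - b ^ r) * b ^ (Module.finrank ℝ E) *
    (vol (Metric.ball (0 : E) 1)).toReal)) ^ (s / (Module.finrank ℝ E + r)), by positivity, ?_⟩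
  intro θ μ α hθ hac hα hψ V hV
  have hlim := Quantization.tendsto_distortion_zero vol hr hη hmomP hα
  have hincr : ∀ᶠ n : ℕ in atTop, Quantization.distortion P r (α n) ≤
      Quantization.distortion P r (α (n + 1)) +
      ENNReal.ofReal (K * (n : ℝ) ^ (-(1 + r / (Module.finrank ℝ E : ℝ)))) := by
    -- All optimal sequences have the same distortions `quantizationError P r n ^ r`, so the
    -- increment bound transfers.
    filter_upwards [hincr₀, eventually_ge_atTop 1] with n hn hn1
    rwa [← (hα n hn1).2.2, ← (hα (n + 1) (by omega)).2.2, (hα₀ n hn1).2.2,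
      (hα₀ (n + 1) (by omega)).2.2]
  obtain ⟨h1, h2⟩ := Quantization.limsup_lintegral_infDist_le vol hf hP hr hs hb hb' hK hα hlim
    hincr hac hψ
  set C := (K / (((1 - b) ^ r - b ^ r) * b ^ (Module.finrank ℝ E) *
    (vol (Metric.ball (0 : E) 1)).toReal)) ^ (s / (Module.finrank ℝ E + r)) with hC
  have hC0 : 0 < C := by positivity
  have hrhs : ENNReal.ofReal (θ ^ (s + (Module.finrank ℝ E : ℝ)) * C) *
      ∫⁻ x, (f (μ + θ • (x - μ)) : ℝ≥0∞) *
        (f x : ℝ≥0∞) ^ (-(s / (Module.finrank ℝ E + r))) ∂vol =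
      ENNReal.ofReal (θ ^ s) * (ENNReal.ofReal C *
        ∫⁻ x, (f x : ℝ≥0∞) ^ (-(s / (Module.finrank ℝ E + r)))
          ∂(Quantization.dilatedLaw θ μ P)) := by
    rw [hP, Quantization.lintegral_dilatedLaw vol hf hθ μ
      (hf.coe_nnreal_ennreal.pow_const _), Real.rpow_add hθ, Real.rpow_natCast,
      ENNReal.ofReal_mul (by positivity), ENNReal.ofReal_mul (by positivity)]
    ring
  rw [hrhs]
  refine ⟨?_, ENNReal.mul_lt_top ENNReal.ofReal_lt_top
    (ENNReal.mul_lt_top ENNReal.ofReal_lt_top h2)⟩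
  calc _ ≤ limsup (fun n : ℕ => ENNReal.ofReal (θ ^ s) *
        ((n : ℝ≥0∞) ^ (s / (Module.finrank ℝ E : ℝ)) *
        ∫⁻ x, ENNReal.ofReal (Metric.infDist x (α n : Set E)) ^ s
          ∂(Quantization.dilatedLaw θ μ P))) atTop := by
        refine limsup_le_limsup ?_
        filter_upwards [eventually_ge_atTop 1] with n hn
        rw [mul_left_comm]
        gcongr
        exact Quantization.lintegral_norm_sub_voronoiQuantization_le hX hθ hs μ (hα n hn).1
          (hV n hn)
    _ = ENNReal.ofReal (θ ^ s) * limsup (fun n : ℕ =>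
        ((n : ℝ≥0∞) ^ (s / (Module.finrank ℝ E : ℝ)) *
        ∫⁻ x, ENNReal.ofReal (Metric.infDist x (α n : Set E)) ^ s
          ∂(Quantization.dilatedLaw θ μ P))) atTop :=
        ENNReal.limsup_const_mul_of_ne_top ENNReal.ofReal_ne_top
    _ ≤ _ := by gcongr
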